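/- Let $(p_n)_{n\ge 1}$ be a sequence in $[0,1]$, let $W_1,W_2,\dots$ be independent random variables with $P(W_n=1)=p_n$ and $P(W_n=0)=1-p_n$, and let $$Y_n=(-1)^{W_1+\dots+W_n},\qquad S_n=Y_1+\dots+Y_n,\qquad S_0=0$$ be the associated coin-turning walk. For real $x\ge 0$ let $S_x$ be defined by linear interpolation. Let $c>0$. (1) If there is an $n_0\ge 1$ with $p_n\le c/n$ for all $n\ge n_0$, and if $\sum_{n} p_n=\infty$, then $S$ is recurrent, that is, $P(S_n=0\text{ for infinitely many }n\mid Y_1)=1$ almost surely. (2) If there is an $n_0\ge 1$ with $p_n= c/n$ for all $n\ge n_0$, then the scaling limit (the zigzag process with parameter $c$) is recurrent as well. That is, (a) every zigzag process $X$ with parameter $c$, and (b) every random element $X$ of $C[0,\infty)$ that is the limit in law, for the locally uniform topology on $C[0,\infty)$, of the rescaled walks $S^{(n)}(t)=S_{nt}/n$, almost surely has zeros at arbitrarily large times: almost surely, for every $T\ge 0$ there is a $t\ge T$ with $X_t=0$. Here a zigzag process with parameter $c$ is a process $X_t=\varepsilon\,(\lambda_b(t)-\lambda_r(t))$, $t\ge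 0$, built from a Poisson point process $N$ on $[0,\infty)$ with intensity measure $\frac{c}{x}\,dx$ and an independent random sign $\varepsilon$ with $P(\varepsilon=1)=P(\varepsilon=-1)=\frac12$, as follows. Fix a reference time $t_0>0$ (the law of $X$ does not depend on it). The points of $N$ cut $(0,\infty)$ into segments, which are coloured alternately blue and red so that the segment containing $t_0$ is blue; $\lambda_b(t)$ and $\lambda_r(t)$ denote the total lengths of the blue and of the red part of $(0,t]$. -/

import Mathlib

open MeasureTheory ProbabilityTheory Filter Topology Set
open scoped NNReal ENNReal

namespace CoinTurning

noncomputable section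

/-! ### The coin-turning walk -/

/-- `W n ω` says whether the coin is turned at step `n ≥ 1`: the events `W 1, W 2, …` are
independent and `W n` has probability `p n` (the index `0` is not used). -/
structure IsTurnSequence {Ω : Type*} [MeasurableSpace Ω] (p : ℕ → ℝ) (W : ℕ → Ω → Bool)
    (P : Measure Ω) : Prop where
  measurable : ∀ n, 1 ≤ n → Measurable (W n)
  indep : iIndepFun (fun n : ℕ => W (n + 1)) P
  prob_turn : ∀ n, 1 ≤ n → P {ω | W n ω = true} = ENNReal.ofReal (p n)

/-- `Y_n = (-1)^(W_1 + ⋯ + W_n)`. -/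
def coin {Ω : Type*} (W : ℕ → Ω → Bool) (n : ℕ) (ω : Ω) : ℤ :=
  (-1) ^ (∑ i ∈ Finset.Icc 1 n, (W i ω).toNat)

/-- `S_n = Y_1 + ⋯ + Y_n`, with `S_0 = 0`. -/
def walk {Ω : Type*} (W : ℕ → Ω → Bool) (n : ℕ) (ω : Ω) : ℤ :=
  ∑ k ∈ Finset.Icc 1 n, coin W k ω

/-- The walk is recurrent: `P(S_n = 0 infinitely often ∣ Y_1) = 1` almost surely. -/
def IsRecurrentWalk {Ω : Type*} [MeasurableSpace Ω] (W : ℕ → Ω → Bool) (P : Measure Ω) : Prop :=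
  P⟦{ω | ∃ᶠ n in atTop, walk W n ω = 0} |
    MeasurableSpace.comap (coin W 1) inferInstance⟧ =ᵐ[P] fun _ => (1 : ℝ)

/-- Linear interpolation of a sequence to `[0, ∞)`. -/
def linInterp (s : ℕ → ℝ) (x : ℝ≥0) : ℝ :=
  s ⌊x⌋₊ + ((x : ℝ) - (⌊x⌋₊ : ℝ)) * (s (⌊x⌋₊ + 1) - s ⌊x⌋₊)

theorem continuous_linInterp (s : ℕ → ℝ) : Continuous (linInterp s) := by
  have hlf : LocallyFinite (fun n : ℕ => Icc (n : ℝ≥0) ((n : ℝ≥0) + 1)) := by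
    intro x
    refine ⟨Iio (x + 1), Iio_mem_nhds (by simp), ?_⟩
    refine (Set.finite_Iio ⌈x + 1⌉₊).subset ?_
    rintro n ⟨y, hy1, hy2⟩
    exact Nat.lt_ceil.2 (lt_of_le_of_lt hy1.1 hy2)
  refine hlf.continuous ?_ (fun n => isClosed_Icc) ?_
  · refine Set.eq_univ_of_forall fun x => Set.mem_iUnion.2 ⟨⌊x⌋₊, ?_, ?_⟩
    · exact Nat.floor_le (zero_le)
    · exact (Nat.lt_floor_add_one x).le
  · intro n
    have hc : ContinuousOn
        (fun x : ℝ≥0 => s n + ((x : ℝ) - (n : ℝ)) * (s (n + 1) - s n))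
        (Icc (n : ℝ≥0) ((n : ℝ≥0) + 1)) := by fun_prop
    refine hc.congr ?_
    rintro x ⟨h1, h2⟩
    rcases h2.lt_or_eq with h | h
    · have hf : ⌊x⌋₊ = n := (Nat.floor_eq_iff (zero_le)).2 ⟨h1, h⟩
      simp [linInterp, hf]
    · have hf : ⌊x⌋₊ = n + 1 := by
        rw [h]; exact_mod_cast Nat.floor_natCast (R := ℝ≥0) (n + 1)
      have hx : (x : ℝ) = n + 1 := by simp [h]
      simp only [linInterp, hf, hx]
      push_cast
      ring

/-- The rescaled walk `t ↦ S_{n t} / n` as a random element of `C[0, ∞)`. -/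
def scaledWalk {Ω : Type*} (W : ℕ → Ω → Bool) (n : ℕ) (ω : Ω) : C(ℝ≥0, ℝ) where
  toFun t := linInterp (fun k => (walk W k ω : ℝ)) ((n : ℝ≥0) * t) / (n : ℝ)
  continuous_toFun := by
    have h := continuous_linInterp (fun k => (walk W k ω : ℝ))
    exact (h.comp (continuous_const.mul continuous_id)).div_const _

/-- `C[0, ∞)` carries the topology of locally uniform convergence and its Borel `σ`-algebra. -/
instance instMeasurableSpacePaths : MeasurableSpace C(ℝ≥0, ℝ) := borel _

instance instBorelSpacePaths : BorelSpace C(ℝ≥0, ℝ) := ⟨rfl⟩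

/-- `Z` is a scaling limit of the walk: the rescaled walks converge to `Z` in law on
`C[0, ∞)`. -/
def IsScalingLimit {Ω Ω' : Type*} [MeasurableSpace Ω] [MeasurableSpace Ω'] (W : ℕ → Ω → Bool)
    (P : Measure Ω) [IsProbabilityMeasure P] (Z : Ω' → C(ℝ≥0, ℝ)) (P' : Measure Ω')
    [IsProbabilityMeasure P'] : Prop :=
  TendstoInDistribution (fun n : ℕ => scaledWalk W n) atTop Z (fun _ => P) P'

/-- A real process indexed by `[0, ∞)` is recurrent: almost surely it has zeros at arbitrarily
large times. -/
def IsRecurrentProcess {Ω : Type*} [MeasurableSpace Ω] (X : ℝ≥0 → Ω → ℝ) (P : Measure Ω) :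
    Prop :=
  ∀ᵐ ω ∂P, ∀ T : ℝ≥0, ∃ t : ℝ≥0, T ≤ t ∧ X t ω = 0

/-! ### Poisson point processes -/

/-- The Poisson law with mean `m ∈ [0, ∞]`; for `m = ∞` it is the point mass at `∞`. -/
def poissonLaw (m : ℝ≥0∞) : Measure ℕ∞ :=
  open Classical in
  if m = ∞ then Measure.dirac ⊤ else (poissonMeasure m.toNNReal).map (fun n : ℕ => (n : ℕ∞))

/-- The number of points of the random set `N` in `A`. -/
def pointCount {Ω : Type*} (N : Ω → Set ℝ) (A : Set ℝ) (ω : Ω) : ℕ∞ := (N ω ∩ A).encard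

/-- The random set `N` is a Poisson point process with (diffuse) intensity measure `μ`: the number
of points in a Borel set `A` is Poisson with mean `μ A`, and the numbers of points in disjoint
Borel sets are independent. -/
structure IsPoissonPointProcess {Ω : Type*} [MeasurableSpace Ω] (N : Ω → Set ℝ) (μ : Measure ℝ)
    (P : Measure Ω) : Prop where
  measurable : ∀ A, MeasurableSet A → Measurable (pointCount N A)
  law : ∀ A, MeasurableSet A → P.map (pointCount N A) = poissonLaw (μ A)
  indep : ∀ (k : ℕ) (A : Fin k → Set ℝ), (∀ i, MeasurableSet (A i)) →
    Pairwise (fun i j => Disjoint (A i) (A j)) → iIndepFun (fun i => pointCount N (A i)) P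

/-! ### The zigzag process -/

/-- The measure `(a / x) dx` on `[0, ∞)`. -/
def zigzagIntensity (a : ℝ) : Measure ℝ :=
  (volume.restrict (Ici 0)).withDensity fun x => ENNReal.ofReal (a / x)

/-- The points of `D` separating `s` from `t`. -/
def pointsBetween (D : Set ℝ) (s t : ℝ) : Set ℝ := D ∩ Ioc (min s t) (max s t)

/-- The points of `D` cut `(0, ∞)` into segments, coloured alternately blue and red, the segment
containing `t₀` being blue. This is the union of the blue segments. -/
def blue (D : Set ℝ) (t₀ : ℝ) : Set ℝ :=
  {s | 0 < s ∧ (pointsBetween D s t₀).Finite ∧ Even (pointsBetween D s t₀).ncard}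

/-- The union of the red segments. -/
def red (D : Set ℝ) (t₀ : ℝ) : Set ℝ :=
  {s | 0 < s ∧ (pointsBetween D s t₀).Finite ∧ Odd (pointsBetween D s t₀).ncard}

/-- The path with turning points `D` which starts from `0` at time `0` and increases at time `t₀`:
its value at time `t` is the length of the blue part of `(0, t]` minus that of the red part. -/
def zigzagPath (D : Set ℝ) (t₀ t : ℝ) : ℝ :=
  (volume (Ioc 0 t ∩ blue D t₀)).toReal - (volume (Ioc 0 t ∩ red D t₀)).toReal

/-- `X` is a zigzag process with parameter `a`: for a Poisson point process `N` on `[0, ∞)` with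
intensity `(a / x) dx`, an independent symmetric random sign `ε` and a reference time `t₀ > 0`
(whose choice does not affect the law), `X_t` is `ε` times the path with turning points `N`
which increases at `t₀`. -/
def IsZigzagProcess {Ω : Type*} [MeasurableSpace Ω] (a : ℝ) (X : ℝ≥0 → Ω → ℝ)
    (P : Measure Ω) : Prop :=
  ∃ (N : Ω → Set ℝ) (ε : Ω → ℝ) (t₀ : ℝ), 0 < t₀ ∧
    IsPoissonPointProcess N (zigzagIntensity a) P ∧
    Measurable ε ∧ P {ω | ε ω = 1} = 1 / 2 ∧ P {ω | ε ω = -1} = 1 / 2 ∧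
    Indep (MeasurableSpace.comap ε inferInstance)
      (⨆ A : {A : Set ℝ // MeasurableSet A},
        MeasurableSpace.comap (pointCount N A.1) inferInstance) P ∧
    ∀ (t : ℝ≥0) (ω : Ω), X t ω = ε ω * zigzagPath (N ω) t₀ t

end

end CoinTurning

namespace CoinTurning

/-! Since `|S_a| ≤ a`, a stretch `(a, 3a]` without turns forces `S_{3a}` to have the sign of the
coin at `a`. If an odd number of turns follows in `(3a, b]` and then none in `(b, 3b]`, the sign of
`S` is reversed by time `3b`. As `S` moves by unit steps, it vanishes in between
(`exists_walk_eq_zero`).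

Such a block has probability bounded below, uniformly in its position. A stretch without turns has
probability at least `exp(-4c)`, because `p_n ≤ c/n`. An odd number of turns has probability at
least `1/4` once `p` has enough mass in `(3a, b]`, by the identity `E ∏ (-1)^{W_i} = ∏ (1 - 2 p_i) =
1 - 2 P(odd)`. Disjoint blocks are independent, so the probability that the first `J` fail decays
geometrically in `J` (`measure_no_zero_le`).

Divergence of `∑ p_n` supplies some `b` for every `a`, which gives (1). If `p_n = c/n`, then `b = L
a` works with one constant `L`, so the bound is invariant under scaling: the rescaled walk has no
zero in `[T, T R^J]` with probability at most `(1 - δ)^J`, uniformly in large `n`. The portmanteau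
theorem carries this over to the limit, which gives (2b). For (2a) the same sign reversal is applied
to the zigzag path, with the pattern "no point, one point, no point" on three consecutive segments
of ratio 3. Each segment has the same Poisson mean `c log 3`. -/

/-- Independent events of probability at least `δ`, supported on disjoint blocks of an independent
family of `σ`-algebras: the probability that the first `J` all fail decays geometrically. -/
theorem measure_biInter_compl_le {ι Ω : Type*} [MeasurableSpace Ω] {P : Measure Ω}
    [IsProbabilityMeasure P] {m : ι → MeasurableSpace Ω} (hle : ∀ i, m i ≤ ‹MeasurableSpace Ω›)
    (hind : iIndep m P) {S : ℕ → Set ι} (hS : Pairwise (Function.onFun Disjoint S))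
    {D : ℕ → Set Ω} (hD : ∀ j, MeasurableSet[⨆ i ∈ S j, m i] (D j)) {δ : ℝ≥0∞}
    (hδ : ∀ j, δ ≤ P (D j)) (J : ℕ) :
    P (⋂ j ∈ Finset.range J, (D j)ᶜ) ≤ (1 - δ) ^ J := by
  induction J with
  | zero => simp
  | succ J ih =>
    have hdisj : Disjoint (⋃ j ∈ Finset.range J, S j) (S J) := by
      simp only [disjoint_iUnion_left, Finset.mem_range]
      exact fun j hj => hS hj.ne
    have h := (Indep_iff _ _ _).1 (indep_iSup_of_disjoint hle hind hdisj)
      (⋂ j ∈ Finset.range J, (D j)ᶜ) (D J)ᶜ ?_ (hD J).compl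
    · rw [Finset.range_add_one, Finset.set_biInter_insert, inter_comm, h, pow_succ]
      gcongr
      have hm : MeasurableSet (D J) :=
        (iSup₂_le fun i _ => hle i : (⨆ i ∈ S J, m i) ≤ _) _ (hD J)
      rw [prob_compl_eq_one_sub hm]
      exact tsub_le_tsub_left (hδ J) 1
    · refine Finset.measurableSet_biInter _ fun j hj => MeasurableSet.compl ?_
      refine (?_ : (⨆ i ∈ S j, m i) ≤ _) _ (hD j)
      exact iSup₂_le fun i hi => le_iSup₂_of_le i (mem_iUnion₂.2 ⟨j, hj, hi⟩) le_rfl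

theorem tendsto_one_sub_pow {δ : ℝ≥0∞} (hδ : 0 < δ) :
    Tendsto (fun J : ℕ => (1 - δ) ^ J) atTop (𝓝 0) :=
  ENNReal.tendsto_pow_atTop_nhds_zero_of_lt_one
    (ENNReal.sub_lt_self ENNReal.one_ne_top one_ne_zero hδ.ne')

/-! ### Zeros of the walk -/

section Walk

variable {Ω : Type*} {W : ℕ → Ω → Bool} {ω : Ω}

/-- The factor `-1` or `1` by which step `i + 1` multiplies the coin. -/
def turnSign (W : ℕ → Ω → Bool) (i : ℕ) (ω : Ω) : ℤ := (-1) ^ (W (i + 1) ω).toNat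

theorem turnSign_eq_ite (i : ℕ) : turnSign W i ω = if W (i + 1) ω = true then -1 else 1 := by
  unfold turnSign
  cases W (i + 1) ω <;> simp

theorem coin_succ (n : ℕ) : coin W (n + 1) ω = coin W n ω * turnSign W n ω := by
  simp [coin, turnSign, Finset.sum_Icc_succ_top, pow_add]

theorem coin_eq_mul_prod {m n : ℕ} (h : m ≤ n) :
    coin W n ω = coin W m ω * ∏ i ∈ Finset.Ico m n, turnSign W i ω := by
  induction n, h using Nat.le_induction with
  | base => simp
  | succ n hn ih => rw [coin_succ, ih, Finset.prod_Ico_succ_top hn, mul_assoc]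

theorem abs_coin (n : ℕ) : |coin W n ω| = 1 := by
  simp [coin, abs_pow]

theorem walk_succ (n : ℕ) : walk W (n + 1) ω = walk W n ω + coin W (n + 1) ω := by
  simp [walk, Finset.sum_Icc_succ_top]

theorem abs_walk_le (n : ℕ) : |walk W n ω| ≤ n := by
  induction n with
  | zero => simp [walk]
  | succ n ih =>
    rw [walk_succ]
    refine (abs_add_le _ _).trans ?_
    rw [abs_coin]
    push_cast
    linarith

theorem walk_eq_add_of_no_turn {m n : ℕ} (h : m ≤ n)
    (hW : ∀ i ∈ Finset.Ico m n, W (i + 1) ω = false) :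
    walk W n ω = walk W m ω + (n - m) * coin W m ω := by
  induction n, h using Nat.le_induction with
  | base => simp
  | succ n hn ih =>
    have hc : coin W (n + 1) ω = coin W m ω := by
      rw [coin_eq_mul_prod (hn.trans n.le_succ), Finset.prod_eq_one, mul_one]
      intro i hi
      simp [turnSign, hW i hi]
    rw [walk_succ, hc, ih fun i hi => hW i (Finset.Ico_subset_Ico_right n.le_succ hi)]
    push_cast
    ring

/-- A discrete intermediate value theorem: an integer sequence that falls by at most 1 per step
cannot jump over 0 on its way down. -/
theorem exists_eq_zero_of_step_le {g : ℕ → ℤ} (hg : ∀ n, g n - 1 ≤ g (n + 1)) {m n : ℕ}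
    (hmn : m ≤ n) (hm : 0 ≤ g m) (hn : g n ≤ 0) : ∃ k, m ≤ k ∧ k ≤ n ∧ g k = 0 := by
  induction n, hmn using Nat.le_induction with
  | base => exact ⟨m, le_rfl, le_rfl, le_antisymm hn hm⟩
  | succ n hmn ih =>
    rcases le_or_gt (g n) 0 with h | h
    · obtain ⟨k, h1, h2, h3⟩ := ih h
      exact ⟨k, h1, h2.trans n.le_succ, h3⟩
    · exact ⟨n + 1, hmn.trans n.le_succ, le_rfl, le_antisymm hn (by linarith [hg n])⟩

/-- No turns at the steps in `(m, n]`. -/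
def noTurn (W : ℕ → Ω → Bool) (m n : ℕ) : Set Ω :=
  {ω | ∀ i ∈ Finset.Ico m n, W (i + 1) ω = false}

/-- An odd number of turns at the steps in `(m, n]`. -/
def oddTurn (W : ℕ → Ω → Bool) (m n : ℕ) : Set Ω :=
  {ω | ∏ i ∈ Finset.Ico m n, turnSign W i ω = -1}

/-- No turns in `(a, 3a]` and in `(b, 3b]`, and an odd number of turns in between. -/
def zeroBlock (W : ℕ → Ω → Bool) (a b : ℕ) : Set Ω :=
  noTurn W a (3 * a) ∩ (oddTurn W (3 * a) b ∩ noTurn W b (3 * b))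

theorem exists_walk_eq_zero {a b : ℕ} (hab : 3 * a ≤ b) (h : ω ∈ zeroBlock W a b) :
    ∃ k, a ≤ k ∧ k ≤ 3 * b ∧ walk W k ω = 0 := by
  obtain ⟨h1, h2, h3⟩ := h
  have w1 := walk_eq_add_of_no_turn (by lia : a ≤ 3 * a) h1
  have w3 := walk_eq_add_of_no_turn (by lia : b ≤ 3 * b) h3
  have c1 : coin W (3 * a) ω = coin W a ω := by
    rw [coin_eq_mul_prod (by lia : a ≤ 3 * a), Finset.prod_eq_one, mul_one]
    intro i hi
    simp [turnSign, h1 i hi]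
  have c2 : coin W b ω = - coin W a ω := by
    rw [coin_eq_mul_prod hab, c1, show ∏ i ∈ Finset.Ico (3 * a) b, turnSign W i ω = -1 from h2]
    ring
  have hsq : coin W a ω = 1 ∨ coin W a ω = -1 := by
    have := abs_coin (W := W) (ω := ω) a
    exact eq_or_eq_neg_of_abs_eq this
  have ba := abs_le.1 (abs_walk_le (W := W) (ω := ω) a)
  have bb := abs_le.1 (abs_walk_le (W := W) (ω := ω) b)
  push_cast at w1 w3
  -- Multiplication by the coin at `a` merges the two signs into one case: the product is at least
  -- `-a + 2a` at time `3a` and at most `b - 2b` at time `3b`.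
  have g0 : ∀ n, coin W a ω * walk W n ω - 1 ≤ coin W a ω * walk W (n + 1) ω := by
    intro n
    have := abs_le.1 (abs_coin (W := W) (ω := ω) (n + 1)).le
    rcases hsq with h | h <;> rw [h, walk_succ] <;> linarith
  have g1 : 0 ≤ coin W a ω * walk W (3 * a) ω := by
    rcases hsq with h | h <;> rw [w1, h] <;> linarith
  have g2 : coin W a ω * walk W (3 * b) ω ≤ 0 := by
    rcases hsq with h | h <;> rw [w3, c2, h] <;> linarith
  obtain ⟨k, hk1, hk2, hk3⟩ := exists_eq_zero_of_step_le
    (g := fun n => coin W a ω * walk W n ω) g0 (by lia : 3 * a ≤ 3 * b) g1 g2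
  refine ⟨k, by lia, hk2, ?_⟩
  rcases hsq with h | h <;> simpa [h] using hk3

end Walk

/-! ### Probability of a zero block -/

theorem exp_neg_two_mul_le_one_sub {x : ℝ} (h0 : 0 ≤ x) (h1 : x ≤ 1 / 2) :
    Real.exp (-(2 * x)) ≤ 1 - x := by
  rw [Real.exp_neg, inv_le_comm₀ (Real.exp_pos _) (by linarith)]
  refine le_trans ?_ (Real.add_one_le_exp _)
  rw [inv_le_iff_one_le_mul₀ (by linarith)]
  nlinarith

theorem integral_ite_neg_one_one {Ω : Type*} [MeasurableSpace Ω] {P : Measure Ω}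
    [IsProbabilityMeasure P] {A : Set Ω} (hA : MeasurableSet A) {f : Ω → ℝ}
    (h1 : ∀ ω ∈ A, f ω = -1) (h2 : ∀ ω ∉ A, f ω = 1) : ∫ ω, f ω ∂P = 1 - 2 * P.real A := by
  have hf : f = fun ω => 1 - A.indicator (fun _ => (2 : ℝ)) ω := by
    funext ω
    by_cases h : ω ∈ A
    · rw [h1 ω h, indicator_of_mem h]; norm_num
    · rw [h2 ω h, indicator_of_notMem h]; norm_num
  rw [hf, integral_sub (integrable_const _) ((integrable_const _).indicator hA),
    integral_indicator_const _ hA]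
  simp [mul_comm]

section

variable {Ω : Type*} {p : ℕ → ℝ} {W : ℕ → Ω → Bool}

/-- The `σ`-algebra generated by the turn at step `i + 1`. -/
abbrev turnAlgebra (W : ℕ → Ω → Bool) (i : ℕ) : MeasurableSpace Ω :=
  MeasurableSpace.comap (W (i + 1)) inferInstance

theorem measurable_turn {S : Set ℕ} {i : ℕ} (hi : i ∈ S) :
    Measurable[⨆ i ∈ S, turnAlgebra W i] (W (i + 1)) :=
  Measurable.of_comap_le (le_iSup₂_of_le i hi le_rfl)

theorem measurableSet_noTurn {S : Set ℕ} {m n : ℕ} (h : ∀ i ∈ Finset.Ico m n, i ∈ S) :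
    MeasurableSet[⨆ i ∈ S, turnAlgebra W i] (noTurn W m n) := by
  have : noTurn W m n = ⋂ i ∈ Finset.Ico m n, W (i + 1) ⁻¹' {false} := by
    ext ω; simp [noTurn]
  rw [this]
  exact Finset.measurableSet_biInter _ fun i hi =>
    measurable_turn (h i hi) (measurableSet_singleton _)

theorem measurableSet_oddTurn {S : Set ℕ} {m n : ℕ} (h : ∀ i ∈ Finset.Ico m n, i ∈ S) :
    MeasurableSet[⨆ i ∈ S, turnAlgebra W i] (oddTurn W m n) := by
  have hm : Measurable[⨆ i ∈ S, turnAlgebra W i]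
      (fun ω => ∏ i ∈ Finset.Ico m n, turnSign W i ω) := by
    refine Finset.measurable_fun_prod _ fun i hi => ?_
    exact (measurable_of_countable (fun b : Bool => (-1 : ℤ) ^ b.toNat)).comp
      (measurable_turn (h i hi))
  exact hm (measurableSet_singleton (-1))

/-- Index `i` stands for step `i + 1`, so `Ico a (3 * b)` covers the steps in `(a, 3b]`. Consecutive
blocks therefore use disjoint index sets. -/
theorem measurableSet_zeroBlock {a b : ℕ} (hab : 3 * a ≤ b) :
    MeasurableSet[⨆ i ∈ Ico a (3 * b), turnAlgebra W i] (zeroBlock W a b) := by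
  refine MeasurableSet.inter (measurableSet_noTurn ?_)
    (MeasurableSet.inter (measurableSet_oddTurn ?_) (measurableSet_noTurn ?_)) <;>
  · intro i hi
    rw [Finset.mem_Ico] at hi
    exact ⟨by lia, by lia⟩

theorem IsTurnSequence.turnAlgebra_le [MeasurableSpace Ω] {P : Measure Ω}
    (hW : IsTurnSequence p W P) (i : ℕ) :
    turnAlgebra W i ≤ ‹MeasurableSpace Ω› :=
  (hW.measurable (i + 1) (by lia)).comap_le

variable [MeasurableSpace Ω] {P : Measure Ω} [IsProbabilityMeasure P]

theorem IsTurnSequence.measure_noTurn (hW : IsTurnSequence p W P) (m n : ℕ) :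
    P (noTurn W m n) = ∏ i ∈ Finset.Ico m n, (1 - ENNReal.ofReal (p (i + 1))) := by
  have : noTurn W m n = ⋂ i ∈ Finset.Ico m n, W (i + 1) ⁻¹' {false} := by
    ext ω; simp [noTurn]
  rw [this, hW.indep.measure_inter_preimage_eq_mul (Finset.Ico m n)
    (sets := fun _ => {false}) fun _ _ => measurableSet_singleton _]
  refine Finset.prod_congr rfl fun i _ => ?_
  have hc : W (i + 1) ⁻¹' {false} = {ω | W (i + 1) ω = true}ᶜ := by
    ext ω; simp
  rw [hc, prob_compl_eq_one_sub, hW.prob_turn _ (by lia)]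
  exact hW.measurable (i + 1) (by lia) (measurableSet_singleton true)

/-- Both sides are the expectation of the product of the turn signs: the left by independence, the
right because the product is `-1` exactly on `oddTurn` and `1` elsewhere. -/
theorem IsTurnSequence.measureReal_oddTurn (hW : IsTurnSequence p W P)
    (hp : ∀ n, 1 ≤ n → p n ∈ Icc (0 : ℝ) 1) (m n : ℕ) :
    ∏ i ∈ Finset.Ico m n, (1 - 2 * p (i + 1)) = 1 - 2 * P.real (oddTurn W m n) := by
  have hmeas : ∀ i, Measurable (fun ω => (turnSign W i ω : ℝ)) := fun i =>
    (measurable_of_countable (fun b : Bool => (((-1 : ℤ) ^ b.toNat : ℤ) : ℝ))).comp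
      (hW.measurable (i + 1) (by lia))
  have hind : iIndepFun (fun (i : Finset.Ico m n) ω => (turnSign W i ω : ℝ)) P :=
    (hW.indep.comp (fun _ (b : Bool) => (((-1 : ℤ) ^ b.toNat : ℤ) : ℝ))
      fun _ => measurable_of_countable _).precomp Subtype.val_injective
  have h := hind.integral_fun_prod_eq_prod_integral fun i => (hmeas i).aestronglyMeasurable
  have hE : ∀ i, ∫ ω, (turnSign W i ω : ℝ) ∂P = 1 - 2 * p (i + 1) := by
    intro i
    rw [integral_ite_neg_one_one (A := {ω | W (i + 1) ω = true})
      (hW.measurable (i + 1) (by lia) (measurableSet_singleton true)), measureReal_def,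
      hW.prob_turn _ (by lia), ENNReal.toReal_ofReal (hp _ (by lia)).1]
    · intro ω hω
      rw [turnSign_eq_ite, if_pos (show W (i + 1) ω = true from hω)]; norm_num
    · intro ω hω
      rw [turnSign_eq_ite, if_neg (show ¬W (i + 1) ω = true from hω)]; norm_num
  simp only [hE] at h
  rw [Finset.prod_coe_sort (Finset.Ico m n) (fun i => 1 - 2 * p (i + 1))] at h
  rw [← h, integral_ite_neg_one_one (A := oddTurn W m n)]
  · exact iSup₂_le (fun i _ => hW.turnAlgebra_le i) _
      (measurableSet_oddTurn (S := univ) fun _ _ => mem_univ _)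
  · intro ω hω
    rw [Finset.prod_coe_sort (Finset.Ico m n) (fun i => (turnSign W i ω : ℝ))]
    exact_mod_cast (hω : ∏ i ∈ Finset.Ico m n, turnSign W i ω = -1)
  · intro ω hω
    rw [Finset.prod_coe_sort (Finset.Ico m n) (fun i => (turnSign W i ω : ℝ))]
    have habs : |∏ i ∈ Finset.Ico m n, turnSign W i ω| = 1 := by
      rw [Finset.abs_prod]
      exact Finset.prod_eq_one fun i _ => by simp [turnSign, abs_pow]
    rcases eq_or_eq_neg_of_abs_eq habs with h | h
    · exact_mod_cast h
    · exact absurd h hω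

theorem IsTurnSequence.le_measure_oddTurn (hW : IsTurnSequence p W P)
    (hp : ∀ n, 1 ≤ n → p n ∈ Icc (0 : ℝ) 1) {m n : ℕ}
    (h : ∏ i ∈ Finset.Ico m n, (1 - 2 * p (i + 1)) ≤ 1 / 2) :
    ENNReal.ofReal (1 / 4) ≤ P (oddTurn W m n) := by
  rw [hW.measureReal_oddTurn hp] at h
  rw [ENNReal.ofReal_le_iff_le_toReal (measure_ne_top _ _)]
  change _ ≤ P.real _
  linarith

/-- Each of the `2a` factors is at least `1 - c/a ≥ exp(-2c/a)`, where `2c ≤ a` ensures `c/a ≤ 1/2`.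
The exponents add up to `-4c`, independently of `a`. -/
theorem IsTurnSequence.le_measure_noTurn (hW : IsTurnSequence p W P) {c : ℝ} (hc : 0 < c) {a : ℕ}
    (ha : 2 * c ≤ a) (hpc : ∀ i, a ≤ i → p (i + 1) ≤ c / (i + 1 : ℕ)) :
    ENNReal.ofReal (Real.exp (-(4 * c))) ≤ P (noTurn W a (3 * a)) := by
  have ha0 : (0 : ℝ) < a := by linarith
  have hca : c / a ≤ 1 / 2 := by
    rw [div_le_iff₀ ha0]; linarith
  have key : ∀ i ∈ Finset.Ico a (3 * a),
      ENNReal.ofReal (Real.exp (-(2 * (c / a)))) ≤ 1 - ENNReal.ofReal (p (i + 1)) := by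
    intro i hi
    have hi := (Finset.mem_Ico.1 hi).1
    have h1 : p (i + 1) ≤ c / a := by
      refine (hpc i hi).trans ?_
      gcongr
      lia
    refine (ENNReal.ofReal_le_ofReal (exp_neg_two_mul_le_one_sub (by positivity) hca)).trans ?_
    rw [ENNReal.ofReal_sub _ (by positivity), ENNReal.ofReal_one]
    exact tsub_le_tsub_left (ENNReal.ofReal_le_ofReal h1) 1
  rw [hW.measure_noTurn]
  refine le_trans ?_ (Finset.prod_le_prod' key)
  rw [Finset.prod_const, Nat.card_Ico, ← ENNReal.ofReal_pow (Real.exp_pos _).le, ← Real.exp_nat_mul]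
  refine ENNReal.ofReal_le_ofReal (Real.exp_le_exp.2 (le_of_eq ?_))
  have : 3 * a - a = 2 * a := by lia
  rw [this]
  push_cast
  field_simp
  ring

/-- A lower bound for the probability of a zero block. -/
noncomputable def blockBound (c : ℝ) : ℝ≥0∞ :=
  ENNReal.ofReal (Real.exp (-(4 * c))) *
    (ENNReal.ofReal (1 / 4) * ENNReal.ofReal (Real.exp (-(4 * c))))

theorem blockBound_pos (c : ℝ) : 0 < blockBound c := by
  have := Real.exp_pos (-(4 * c))
  refine ENNReal.mul_pos ?_ (mul_ne_zero ?_ ?_) <;> simp [this]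

theorem IsTurnSequence.blockBound_le (hW : IsTurnSequence p W P)
    (hp : ∀ n, 1 ≤ n → p n ∈ Icc (0 : ℝ) 1) {c : ℝ} (hc : 0 < c) {a b : ℕ} (hab : 3 * a ≤ b)
    (ha : 2 * c ≤ a) (hpc : ∀ i, a ≤ i → p (i + 1) ≤ c / (i + 1 : ℕ))
    (h : ∏ i ∈ Finset.Ico (3 * a) b, (1 - 2 * p (i + 1)) ≤ 1 / 2) :
    blockBound c ≤ P (zeroBlock W a b) := by
  have hind : iIndep (turnAlgebra W) P := hW.indep.iIndep
  have hab' : (a : ℝ) ≤ b := by exact_mod_cast (by lia : a ≤ b)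
  have d1 : Disjoint (Ico a (3 * a)) (Ico (3 * a) (3 * b)) :=
    Set.disjoint_left.2 fun x hx hy => by have := hx.2; have := hy.1; lia
  have d2 : Disjoint (Ico (3 * a) b) (Ico b (3 * b)) :=
    Set.disjoint_left.2 fun x hx hy => by have := hx.2; have := hy.1; lia
  have i1 := (Indep_iff _ _ _).1 (indep_iSup_of_disjoint hW.turnAlgebra_le hind d1)
    (noTurn W a (3 * a)) (oddTurn W (3 * a) b ∩ noTurn W b (3 * b))
    (measurableSet_noTurn fun i hi => by simpa using hi)
    (MeasurableSet.inter
      (measurableSet_oddTurn fun i hi => by rw [Finset.mem_Ico] at hi; exact ⟨by lia, by lia⟩)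
      (measurableSet_noTurn fun i hi => by rw [Finset.mem_Ico] at hi; exact ⟨by lia, by lia⟩))
  have i2 := (Indep_iff _ _ _).1 (indep_iSup_of_disjoint hW.turnAlgebra_le hind d2)
    (oddTurn W (3 * a) b) (noTurn W b (3 * b))
    (measurableSet_oddTurn fun i hi => by simpa using hi)
    (measurableSet_noTurn fun i hi => by simpa using hi)
  rw [zeroBlock, i1, i2]
  exact mul_le_mul' (hW.le_measure_noTurn hc ha hpc)
    (mul_le_mul' (hW.le_measure_oddTurn hp h)
      (hW.le_measure_noTurn hc (by linarith) fun i hi => hpc i (by lia)))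

/-- If `β` prolongs blocks far enough, the walk has a zero in a long window with high
probability. -/
theorem IsTurnSequence.measure_no_zero_le (hW : IsTurnSequence p W P)
    (hp : ∀ n, 1 ≤ n → p n ∈ Icc (0 : ℝ) 1) {c : ℝ} (hc : 0 < c) {a₀ : ℕ} (ha₀ : 2 * c ≤ a₀)
    (hpc : ∀ i, a₀ ≤ i → p (i + 1) ≤ c / (i + 1 : ℕ)) {β : ℕ → ℕ} (hβ : ∀ a, 3 * a ≤ β a)
    (hodd : ∀ a, a₀ ≤ a → ∏ i ∈ Finset.Ico (3 * a) (β a), (1 - 2 * p (i + 1)) ≤ 1 / 2)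
    {a : ℕ} (ha : a₀ ≤ a) (J : ℕ) :
    P {ω | ∀ k, a ≤ k → k ≤ (fun a => 3 * β a)^[J] a → walk W k ω ≠ 0} ≤
      (1 - blockBound c) ^ J := by
  -- Block `j` starts at `s j` and ends at `3 β(s j) = s (j + 1)`, where the next one begins.
  set s : ℕ → ℕ := fun j => (fun a => 3 * β a)^[j] a with hs
  have hstep : ∀ j, s (j + 1) = 3 * β (s j) := fun j => Function.iterate_succ_apply' _ _ _
  have hmono : Monotone s := monotone_nat_of_le_succ fun j => by
    have := hβ (s j)
    rw [hstep]; lia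
  have hle : ∀ j, a ≤ s j := fun j => hmono (Nat.zero_le j)
  have h := measure_biInter_compl_le hW.turnAlgebra_le hW.indep.iIndep
    (S := fun j => Ico (s j) (s (j + 1))) hmono.pairwise_disjoint_on_Ico_succ
    (D := fun j => zeroBlock W (s j) (β (s j)))
    (fun j => by rw [hstep]; exact measurableSet_zeroBlock (hβ _))
    (fun j => hW.blockBound_le hp hc (hβ _)
      (ha₀.trans (by exact_mod_cast ha.trans (hle j)))
      (fun i hi => hpc i (ha.trans ((hle j).trans hi))) (hodd _ (ha.trans (hle j)))) J
  refine (measure_mono fun ω hω => ?_).trans h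
  simp only [mem_iInter, Finset.mem_range]
  intro j hj hD
  obtain ⟨k, h1, h2, h3⟩ := exists_walk_eq_zero (hβ _) hD
  refine hω k ((hle j).trans h1) (h2.trans ?_) h3
  rw [← hstep]
  exact hmono hj

end

/-! ### How long a block must be -/

theorem prod_one_sub_two_mul_le {q : ℕ → ℝ} {m n : ℕ} (h1 : ∀ i, m ≤ i → q i ≤ 1 / 2)
    (h : 1 / 2 ≤ ∑ i ∈ Finset.Ico m n, q i) :
    ∏ i ∈ Finset.Ico m n, (1 - 2 * q i) ≤ 1 / 2 := by
  calc ∏ i ∈ Finset.Ico m n, (1 - 2 * q i)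
      ≤ ∏ i ∈ Finset.Ico m n, Real.exp (-(2 * q i)) := by
        refine Finset.prod_le_prod (fun i hi => ?_) fun i _ => Real.one_sub_le_exp_neg _
        -- `q i ≤ 1/2` keeps the factors nonnegative, as a termwise comparison of products requires.
        linarith [h1 i (Finset.mem_Ico.1 hi).1]
    _ = Real.exp (-(2 * ∑ i ∈ Finset.Ico m n, q i)) := by
        rw [← Real.exp_sum, Finset.sum_neg_distrib, Finset.mul_sum]
    _ ≤ Real.exp (-1) := Real.exp_le_exp.2 (by linarith)
    _ ≤ 1 / 2 := by
        rw [Real.exp_neg, inv_le_comm₀ (Real.exp_pos _) (by norm_num)]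
        linarith [Real.add_one_le_exp (1 : ℝ)]

theorem exists_half_le_sum_Ico {q : ℕ → ℝ}
    (h : Tendsto (fun n : ℕ => ∑ k ∈ Finset.range n, q k) atTop atTop) (m : ℕ) :
    ∃ n, m ≤ n ∧ 1 / 2 ≤ ∑ i ∈ Finset.Ico m n, q i := by
  obtain ⟨n, hmn, hn⟩ := ((eventually_ge_atTop m).and
    (h.eventually_ge_atTop (1 / 2 + ∑ k ∈ Finset.range m, q k))).exists
  refine ⟨n, hmn, ?_⟩
  rw [Finset.sum_Ico_eq_sub _ hmn]
  linarith

theorem log_sub_log_le_sum_Ico {m n : ℕ} (h : m ≤ n) :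
    Real.log (n + 1) - Real.log (m + 1) ≤ ∑ i ∈ Finset.Ico m n, 1 / ((i + 1 : ℕ) : ℝ) := by
  induction n, h using Nat.le_induction with
  | base => simp
  | succ n hn ih =>
    rw [Finset.sum_Ico_succ_top hn]
    have hpos : (0 : ℝ) < n + 1 := by positivity
    have h2 := Real.log_le_sub_one_of_pos (x := ((n : ℝ) + 1 + 1) / (n + 1)) (by positivity)
    rw [Real.log_div (by positivity) (by positivity)] at h2
    have h3 : ((n : ℝ) + 1 + 1) / (n + 1) - 1 = 1 / ((n + 1 : ℕ) : ℝ) := by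
      push_cast
      field_simp
      ring
    push_cast at *
    linarith

/-- Harmonic sums over `(3a, La]` are about `log (L/3)`, so one `L` serves all `a`. This uniformity
is what survives rescaling. -/
theorem exists_half_le_mul_sum_Ico {c : ℝ} (hc : 0 < c) :
    ∃ L : ℕ, 3 ≤ L ∧ ∀ a : ℕ, 1 ≤ a →
      1 / 2 ≤ ∑ i ∈ Finset.Ico (3 * a) (L * a), c / ((i + 1 : ℕ) : ℝ) := by
  -- `M` is chosen so that `c log M ≥ 1/2`; the factor 4 instead of 3 absorbs the shifts, as `(4Ma +
  -- 1)/(3a + 1) ≥ M` for `a ≥ 1`.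
  set M := ⌈Real.exp (1 / (2 * c))⌉₊ with hM
  have hM1 : 1 ≤ M := Nat.one_le_ceil_iff.2 (Real.exp_pos _)
  refine ⟨4 * M, by lia, fun a ha => ?_⟩
  have hle : 3 * a ≤ 4 * M * a := Nat.mul_le_mul_right a (by lia)
  have hlog := log_sub_log_le_sum_Ico hle
  have ha' : (1 : ℝ) ≤ a := by exact_mod_cast ha
  have hM' : (1 : ℝ) ≤ M := by exact_mod_cast hM1
  have h1 : 1 / (2 * c) ≤ Real.log ((4 * M * a : ℕ) + 1) - Real.log ((3 * a : ℕ) + 1) := by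
    rw [← Real.log_div (by positivity) (by positivity), Real.le_log_iff_exp_le (by positivity)]
    refine (Nat.le_ceil _).trans ?_
    rw [← hM, le_div_iff₀ (by positivity)]
    push_cast
    nlinarith
  have h2 : ∑ i ∈ Finset.Ico (3 * a) (4 * M * a), c / ((i + 1 : ℕ) : ℝ) =
      c * ∑ i ∈ Finset.Ico (3 * a) (4 * M * a), 1 / ((i + 1 : ℕ) : ℝ) := by
    rw [Finset.mul_sum]
    exact Finset.sum_congr rfl fun i _ => by ring
  rw [h2]
  have h3 : c * (1 / (2 * c)) = 1 / 2 := by field_simp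
  rw [← h3]
  exact mul_le_mul_of_nonneg_left (h1.trans hlog) hc.le

theorem scaledWalk_div {Ω : Type*} {W : ℕ → Ω → Bool} {n : ℕ} (hn : n ≠ 0) (k : ℕ)
    (ω : Ω) :
    scaledWalk W n ω ((k : ℝ≥0) / n) = walk W k ω / n := by
  have h : (n : ℝ≥0) * ((k : ℝ≥0) / n) = k := by
    field_simp
  change linInterp _ _ / _ = _
  rw [h]
  simp [linInterp]

/-! ### Almost sure recurrence -/

section

variable {Ω : Type*} [MeasurableSpace Ω] {P : Measure Ω} [IsProbabilityMeasure P]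
  {p : ℕ → ℝ} {W : ℕ → Ω → Bool}

/-- From some index on, `p` lies below `c / n ≤ 1 / 2`. -/
theorem exists_start {c : ℝ} {n₀ : ℕ} (h : ∀ n, n₀ ≤ n → p n ≤ c / n) :
    ∃ a₀ : ℕ, 1 ≤ a₀ ∧ 2 * c ≤ a₀ ∧ (∀ i, a₀ ≤ i → p (i + 1) ≤ c / (i + 1 : ℕ)) ∧
      (∀ i, a₀ ≤ i → p (i + 1) ≤ 1 / 2) ∧ n₀ ≤ a₀ := by
  refine ⟨max n₀ (max 1 ⌈2 * c⌉₊), by lia, ?_, fun i hi => h _ (by lia), fun i hi => ?_, by lia⟩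
  · exact (Nat.le_ceil _).trans (by exact_mod_cast (by lia))
  · refine (h _ (by lia)).trans ?_
    have h1 : 2 * c ≤ i := (Nat.le_ceil _).trans (by exact_mod_cast (by lia))
    rw [div_le_iff₀ (by positivity)]
    push_cast
    linarith

theorem IsTurnSequence.ae_frequently_walk_eq_zero (hW : IsTurnSequence p W P)
    (hp : ∀ n, 1 ≤ n → p n ∈ Icc (0 : ℝ) 1) {c : ℝ} (hc : 0 < c) {n₀ : ℕ}
    (h : ∀ n, n₀ ≤ n → p n ≤ c / n)
    (hsum : Tendsto (fun n : ℕ => ∑ k ∈ Finset.Icc 1 n, p k) atTop atTop) :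
    ∀ᵐ ω ∂P, ∃ᶠ n in atTop, walk W n ω = 0 := by
  obtain ⟨a₀, -, ha₀, hpc, hhalf, -⟩ := exists_start h
  have hsum' : Tendsto (fun n : ℕ => ∑ k ∈ Finset.range n, p (k + 1)) atTop atTop := by
    refine hsum.congr fun n => ?_
    rw [Finset.range_eq_Ico, Finset.sum_Ico_add' p 0 n 1]
    rfl
  choose β hβ1 hβ2 using fun a => exists_half_le_sum_Ico hsum' (3 * a)
  simp only [frequently_atTop]
  rw [ae_all_iff]
  intro n
  have hb := hW.measure_no_zero_le hp hc ha₀ hpc hβ1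
    (fun a ha => prod_one_sub_two_mul_le (fun i hi => hhalf i (by lia)) (hβ2 a))
    (le_max_right n a₀)
  rw [ae_iff]
  refine le_antisymm (ge_of_tendsto' (tendsto_one_sub_pow (blockBound_pos c)) fun J => ?_) bot_le
  refine (measure_mono fun ω hω k hk _ h0 => ?_).trans (hb J)
  exact hω ⟨k, (le_max_left _ _).trans hk, h0⟩

/-- The indicator of an almost sure event equals 1 almost surely, hence so does its conditional
expectation. -/
theorem IsTurnSequence.isRecurrentWalk (hW : IsTurnSequence p W P)
    (h : ∀ᵐ ω ∂P, ∃ᶠ n in atTop, walk W n ω = 0) : IsRecurrentWalk W P := by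
  have hm : MeasurableSpace.comap (coin W 1) inferInstance ≤ ‹MeasurableSpace Ω› := by
    refine Measurable.comap_le ?_
    have : coin W 1 = fun ω => (-1 : ℤ) ^ (W 1 ω).toNat := by
      funext ω; simp [coin]
    rw [this]
    exact (measurable_of_countable (fun b : Bool => (-1 : ℤ) ^ b.toNat)).comp
      (hW.measurable 1 le_rfl)
  unfold IsRecurrentWalk
  refine (condExp_congr_ae (g := fun _ => (1 : ℝ)) ?_).trans
    (condExp_const hm (1 : ℝ)).eventuallyEq
  filter_upwards [h] with ω hω
  exact indicator_of_mem (s := {ω | ∃ᶠ n in atTop, walk W n ω = 0}) hω _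

/-! ### Zeros of the scaling limit -/

/-- Compactness of the interval makes the absence of zeros an open condition, which is the form the
portmanteau inequality needs. -/
theorem isOpen_setOf_forall_Icc_ne_zero (S T : ℝ≥0) :
    IsOpen {f : C(ℝ≥0, ℝ) | ∀ t ∈ Icc S T, f t ≠ 0} :=
  ContinuousMap.isOpen_setOfPred_mapsTo (isCompact_Icc (a := S) (b := T))
    (isOpen_compl_singleton (x := (0 : ℝ)))

/-- Neither the window nor the bound depends on `n`: blocks started at `nT` with `β a = L a` reach
`n T (3L)^J`, and a zero of the walk at `k` is a zero of the rescaled walk at `k/n`. -/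
theorem IsTurnSequence.measure_scaledWalk_le (hW : IsTurnSequence p W P)
    (hp : ∀ n, 1 ≤ n → p n ∈ Icc (0 : ℝ) 1) {c : ℝ} (hc : 0 < c) {n₀ : ℕ}
    (h : ∀ n, n₀ ≤ n → p n = c / n) :
    ∃ R a₀ : ℕ, ∀ n T J : ℕ, a₀ ≤ n → 1 ≤ T →
      P {ω | ∀ t ∈ Icc (T : ℝ≥0) (T * R ^ J : ℕ), scaledWalk W n ω t ≠ 0} ≤
        (1 - blockBound c) ^ J := by
  obtain ⟨a₀, h1, ha₀, hpc, hhalf, hn₀⟩ := exists_start fun n hn => (h n hn).le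
  obtain ⟨L, hL, hsum⟩ := exists_half_le_mul_sum_Ico hc
  refine ⟨3 * L, a₀, fun n T J hn hT => ?_⟩
  have hb := hW.measure_no_zero_le hp hc ha₀ hpc (β := fun a => L * a)
    (fun a => Nat.mul_le_mul_right a hL) (fun a ha => ?_)
    (hn.trans (Nat.le_mul_of_pos_right n hT)) J
  · have hit : (fun a => 3 * (L * a))^[J] (n * T) = n * (T * (3 * L) ^ J) := by
      have : (fun a => 3 * (L * a)) = fun a => (3 * L) * a := by
        funext a; ring
      rw [this, mul_left_iterate]
      ring
    rw [hit] at hb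
    refine (measure_mono fun ω hω k hk1 hk2 h0 => ?_).trans hb
    have hn0 : n ≠ 0 := by lia
    have hn0' : (0 : ℝ≥0) < n := by exact_mod_cast Nat.pos_of_ne_zero hn0
    refine hω ((k : ℝ≥0) / n) ⟨?_, ?_⟩ ?_
    · rw [le_div_iff₀ hn0', mul_comm]
      exact_mod_cast hk1
    · rw [div_le_iff₀ hn0', mul_comm]
      exact_mod_cast hk2
    · rw [scaledWalk_div hn0, h0]
      simp
  · refine prod_one_sub_two_mul_le (fun i hi => hhalf i (by lia)) ((hsum a (by lia)).trans_eq ?_)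
    refine Finset.sum_congr rfl fun i hi => ?_
    rw [Finset.mem_Ico] at hi
    exact (h (i + 1) (by lia)).symm

theorem IsTurnSequence.isRecurrentProcess_scalingLimit (hW : IsTurnSequence p W P)
    (hp : ∀ n, 1 ≤ n → p n ∈ Icc (0 : ℝ) 1) {c : ℝ} (hc : 0 < c) {n₀ : ℕ}
    (h : ∀ n, n₀ ≤ n → p n = c / n) {Ω' : Type*} [MeasurableSpace Ω'] {P' : Measure Ω'}
    [IsProbabilityMeasure P'] {Z : Ω' → C(ℝ≥0, ℝ)} (hZ : IsScalingLimit W P Z P') :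
    IsRecurrentProcess (fun t ω => Z ω t) P' := by
  obtain ⟨R, a₀, hR⟩ := hW.measure_scaledWalk_le hp hc h
  have key : ∀ T : ℕ, 1 ≤ T → ∀ᵐ ω ∂P', ∃ t : ℝ≥0, (T : ℝ≥0) ≤ t ∧ Z ω t = 0 := by
    intro T hT
    rw [ae_iff]
    refine le_antisymm (ge_of_tendsto' (tendsto_one_sub_pow (blockBound_pos c)) fun J => ?_) bot_le
    have hopen := isOpen_setOf_forall_Icc_ne_zero (T : ℝ≥0) (T * R ^ J : ℕ)
    have hlim := ProbabilityMeasure.le_liminf_measure_open_of_tendsto hZ.tendsto hopen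
    have hle : ∀ᶠ n in atTop, P.map (scaledWalk W n)
        {f : C(ℝ≥0, ℝ) | ∀ t ∈ Icc (T : ℝ≥0) (T * R ^ J : ℕ), f t ≠ 0} ≤
          (1 - blockBound c) ^ J := by
      filter_upwards [eventually_ge_atTop a₀] with n hn
      rw [Measure.map_apply_of_aemeasurable (hZ.forall_aemeasurable n) hopen.measurableSet]
      exact hR n T J hn hT
    have hlim' := hlim.trans (liminf_le_of_frequently_le' hle.frequently)
    change P'.map Z _ ≤ _ at hlim'
    rw [Measure.map_apply_of_aemeasurable hZ.aemeasurable_limit hopen.measurableSet] at hlim'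
    refine (measure_mono fun ω hω t ht h0 => ?_).trans hlim'
    exact hω ⟨t, ht.1, h0⟩
  -- The shift to `T + 1` avoids `T = 0`, where the window `[T, T R^J]` degenerates.
  have hall : ∀ᵐ ω ∂P', ∀ T : ℕ, ∃ t : ℝ≥0, ((T + 1 : ℕ) : ℝ≥0) ≤ t ∧ Z ω t = 0 :=
    ae_all_iff.2 fun T => key (T + 1) (by lia)
  filter_upwards [hall] with ω hω T
  obtain ⟨t, ht, h0⟩ := hω ⌈T⌉₊
  exact ⟨t, (Nat.le_ceil T).trans ((Nat.cast_le.2 (Nat.le_succ _)).trans ht), h0⟩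

end

/-! ### Zeros of zigzag paths -/

/-- The cut is made along a measurable interval, so `B` may be arbitrary; the coloured sets need not
be shown measurable. -/
theorem toReal_volume_Ioc_inter_add (B : Set ℝ) {r s t : ℝ} (hrs : r ≤ s) (hst : s ≤ t) :
    (volume (Ioc r t ∩ B)).toReal =
      (volume (Ioc r s ∩ B)).toReal + (volume (Ioc s t ∩ B)).toReal := by
  have hfin : ∀ u v : ℝ, volume (Ioc u v ∩ B) ≠ ∞ := fun u v =>
    measure_ne_top_of_subset inter_subset_left (by simp)
  rw [← ENNReal.toReal_add (hfin _ _) (hfin _ _),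
    ← measure_inter_add_sdiff (Ioc r t ∩ B) (measurableSet_Ioc (a := r) (b := s))]
  congr 3
  · ext x; simp only [mem_inter_iff, mem_Ioc]
    constructor
    · rintro ⟨⟨-, h⟩, h'⟩; exact ⟨h', h⟩
    · rintro ⟨h, h'⟩; exact ⟨⟨⟨h.1, h.2.trans hst⟩, h'⟩, h⟩
  · ext x; simp only [mem_inter_iff, mem_Ioc, Set.mem_sdiff, not_and, not_le]
    constructor
    · rintro ⟨⟨h, h'⟩, h''⟩; exact ⟨⟨h'' h.1, h.2⟩, h'⟩
    · rintro ⟨h, h'⟩; exact ⟨⟨⟨hrs.trans_lt h.1, h.2⟩, h'⟩, fun _ => h.1⟩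

theorem toReal_volume_Ioc_inter_le (B : Set ℝ) {s t : ℝ} (hst : s ≤ t) :
    (volume (Ioc s t ∩ B)).toReal ≤ t - s := by
  refine ENNReal.toReal_le_of_le_ofReal (by linarith) ?_
  exact (measure_mono inter_subset_left).trans_eq Real.volume_Ioc

theorem zigzagPath_sub (D : Set ℝ) (t₀ : ℝ) {s t : ℝ} (hs : 0 ≤ s) (hst : s ≤ t) :
    zigzagPath D t₀ t - zigzagPath D t₀ s =
      (volume (Ioc s t ∩ blue D t₀)).toReal - (volume (Ioc s t ∩ red D t₀)).toReal := by
  rw [zigzagPath, zigzagPath, toReal_volume_Ioc_inter_add _ hs hst,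
    toReal_volume_Ioc_inter_add (red D t₀) hs hst]
  ring

theorem abs_zigzagPath_sub_le (D : Set ℝ) (t₀ : ℝ) {s t : ℝ} (hs : 0 ≤ s) (hst : s ≤ t) :
    |zigzagPath D t₀ t - zigzagPath D t₀ s| ≤ t - s := by
  rw [zigzagPath_sub D t₀ hs hst]
  have h1 := toReal_volume_Ioc_inter_le (blue D t₀) hst
  have h2 := toReal_volume_Ioc_inter_le (red D t₀) hst
  have h3 : 0 ≤ (volume (Ioc s t ∩ blue D t₀)).toReal := ENNReal.toReal_nonneg
  have h4 : 0 ≤ (volume (Ioc s t ∩ red D t₀)).toReal := ENNReal.toReal_nonneg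
  exact abs_le.2 ⟨by linarith, by linarith⟩

theorem abs_zigzagPath_le (D : Set ℝ) (t₀ : ℝ) {t : ℝ} (ht : 0 ≤ t) : |zigzagPath D t₀ t| ≤ t := by
  have h := abs_zigzagPath_sub_le D t₀ le_rfl ht
  simpa [zigzagPath] using h

theorem continuousOn_zigzagPath (D : Set ℝ) (t₀ : ℝ) : ContinuousOn (zigzagPath D t₀) (Ici 0) := by
  refine (LipschitzOnWith.of_dist_le_mul (K := 1) fun x hx y hy => ?_).continuousOn
  rw [Real.dist_eq, Real.dist_eq, NNReal.coe_one, one_mul]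
  rcases le_total x y with h | h
  · rw [abs_sub_comm, abs_sub_comm x y]
    exact (abs_zigzagPath_sub_le D t₀ hx h).trans (le_abs_self _)
  · exact (abs_zigzagPath_sub_le D t₀ hy h).trans (le_abs_self _)

theorem pointsBetween_of_le {D : Set ℝ} {t₀ s : ℝ} (h : t₀ ≤ s) :
    pointsBetween D s t₀ = D ∩ Ioc t₀ s := by
  rw [pointsBetween, min_eq_right h, max_eq_left h]

section

variable {D : Set ℝ} {t₀ u v : ℝ}

theorem inter_Ioc_eq_of_empty (he : D ∩ Ioc u v = ∅) {s : ℝ} (hs : s ∈ Ioc u v) :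
    D ∩ Ioc t₀ s = D ∩ Ioc t₀ u := by
  ext x
  constructor
  · rintro ⟨hx, h1, h2⟩
    refine ⟨hx, h1, le_of_not_gt fun h => ?_⟩
    exact (he.subset ⟨hx, h, h2.trans hs.2⟩ : x ∈ (∅ : Set ℝ))
  · rintro ⟨hx, h1, h2⟩
    exact ⟨hx, h1, h2.trans hs.1.le⟩

/-- Without points in `(u, v]` the colour there is constant, given by the parity of the number of
points in `(t₀, u]`. -/
theorem zigzagPath_eq_add_of_even (ht₀ : 0 < t₀) (h0 : t₀ ≤ u) (huv : u ≤ v)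
    (he : D ∩ Ioc u v = ∅) (hfin : (D ∩ Ioc t₀ u).Finite) (hev : Even (D ∩ Ioc t₀ u).ncard) :
    zigzagPath D t₀ v = zigzagPath D t₀ u + (v - u) := by
  have hb : Ioc u v ∩ blue D t₀ = Ioc u v := by
    refine inter_eq_left.2 fun s hs => ?_
    refine ⟨by linarith [hs.1], ?_⟩
    rw [pointsBetween_of_le (h0.trans hs.1.le), inter_Ioc_eq_of_empty he hs]
    exact ⟨hfin, hev⟩
  have hr : Ioc u v ∩ red D t₀ = ∅ := by
    refine eq_empty_of_forall_notMem fun s ⟨hs, h⟩ => ?_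
    have h := h.2.2
    rw [pointsBetween_of_le (h0.trans hs.1.le), inter_Ioc_eq_of_empty he hs] at h
    exact Nat.not_even_iff_odd.2 h hev
  have h := zigzagPath_sub D t₀ (by linarith : 0 ≤ u) huv
  rw [hb, hr, Real.volume_Ioc, ENNReal.toReal_ofReal (by linarith)] at h
  simp at h
  linarith

theorem zigzagPath_eq_sub_of_odd (ht₀ : 0 < t₀) (h0 : t₀ ≤ u) (huv : u ≤ v)
    (he : D ∩ Ioc u v = ∅) (hfin : (D ∩ Ioc t₀ u).Finite) (hodd : Odd (D ∩ Ioc t₀ u).ncard) :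
    zigzagPath D t₀ v = zigzagPath D t₀ u - (v - u) := by
  have hr : Ioc u v ∩ red D t₀ = Ioc u v := by
    refine inter_eq_left.2 fun s hs => ?_
    refine ⟨by linarith [hs.1], ?_⟩
    rw [pointsBetween_of_le (h0.trans hs.1.le), inter_Ioc_eq_of_empty he hs]
    exact ⟨hfin, hodd⟩
  have hb : Ioc u v ∩ blue D t₀ = ∅ := by
    refine eq_empty_of_forall_notMem fun s ⟨hs, h⟩ => ?_
    have h := h.2.2
    rw [pointsBetween_of_le (h0.trans hs.1.le), inter_Ioc_eq_of_empty he hs] at h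
    exact Nat.not_even_iff_odd.2 hodd h
  have h := zigzagPath_sub D t₀ (by linarith : 0 ≤ u) huv
  rw [hb, hr, Real.volume_Ioc, ENNReal.toReal_ofReal (by linarith)] at h
  simp at h
  linarith

theorem ncard_inter_Ioc_add {w : ℝ} (h0 : t₀ ≤ u) (huw : u ≤ w)
    (hfin : (D ∩ Ioc t₀ w).Finite) :
    (D ∩ Ioc t₀ w).ncard = (D ∩ Ioc t₀ u).ncard + (D ∩ Ioc u w).ncard := by
  have hu : (D ∩ Ioc t₀ u).Finite :=
    hfin.subset (inter_subset_inter_right _ (Ioc_subset_Ioc_right huw))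
  have hw : (D ∩ Ioc u w).Finite :=
    hfin.subset (inter_subset_inter_right _ (Ioc_subset_Ioc_left h0))
  rw [← Ioc_union_Ioc_eq_Ioc h0 huw, inter_union_distrib_left, ncard_union_eq _ hu hw]
  refine Disjoint.mono inter_subset_right inter_subset_right ?_
  exact Set.disjoint_left.2 fun x hx hy => not_lt_of_ge hx.2 hy.1

/-- The continuous analogue of `exists_walk_eq_zero`: `|X_u| ≤ u` is outweighed by a run of length
`2u`, `|X_{9u}| ≤ 9u` by a run of length `18u`, and the single point between makes the two runs
opposite. -/
theorem exists_zigzagPath_eq_zero (ht₀ : 0 < t₀) (hfin : ∀ s, (D ∩ Ioc t₀ s).Finite)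
    (h0 : t₀ ≤ u) (he : D ∩ Ioc u (3 * u) = ∅) (h1 : (D ∩ Ioc (3 * u) (9 * u)).ncard = 1)
    (he' : D ∩ Ioc (9 * u) (27 * u) = ∅) : ∃ t, u ≤ t ∧ zigzagPath D t₀ t = 0 := by
  have hu : 0 < u := ht₀.trans_le h0
  have n3 : (D ∩ Ioc t₀ (3 * u)).ncard = (D ∩ Ioc t₀ u).ncard := by
    rw [ncard_inter_Ioc_add h0 (by linarith) (hfin _), he, ncard_empty, add_zero]
  have n9 : (D ∩ Ioc t₀ (9 * u)).ncard = (D ∩ Ioc t₀ u).ncard + 1 := by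
    rw [ncard_inter_Ioc_add (u := 3 * u) (by linarith) (by linarith) (hfin _), n3, h1]
  have b1 := abs_le.1 (abs_zigzagPath_le D t₀ hu.le)
  have b9 := abs_le.1 (abs_zigzagPath_le D t₀ (by linarith : 0 ≤ 9 * u))
  have hcont : ContinuousOn (zigzagPath D t₀) (uIcc (3 * u) (27 * u)) := by
    rw [uIcc_of_le (by linarith)]
    exact (continuousOn_zigzagPath D t₀).mono fun x hx => (by linarith [hx.1] : (0 : ℝ) ≤ x)
  have hmem : (0 : ℝ) ∈ uIcc (zigzagPath D t₀ (3 * u)) (zigzagPath D t₀ (27 * u)) := by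
    rcases Nat.even_or_odd (D ∩ Ioc t₀ u).ncard with h | h
    · have e1 := zigzagPath_eq_add_of_even ht₀ h0 (by linarith) he (hfin _) h
      have e2 := zigzagPath_eq_sub_of_odd ht₀ (by linarith) (by linarith) he' (hfin _)
        (by rw [n9]; exact h.add_one)
      exact mem_uIcc.2 (Or.inr ⟨by linarith, by linarith⟩)
    · have e1 := zigzagPath_eq_sub_of_odd ht₀ h0 (by linarith) he (hfin _) h
      have e2 := zigzagPath_eq_add_of_even ht₀ (by linarith) (by linarith) he' (hfin _)
        (by rw [n9]; exact h.add_one)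
      exact mem_uIcc.2 (Or.inl ⟨by linarith, by linarith⟩)
  obtain ⟨t, ht, h⟩ := intermediate_value_uIcc hcont hmem
  rw [uIcc_of_le (by linarith)] at ht
  exact ⟨t, by linarith [ht.1], h⟩

end

/-! ### Poisson point processes with intensity `(a / x) dx` -/

theorem zigzagIntensity_Ioc {a s t : ℝ} (ha : 0 < a) (hs : 0 < s) (hst : s ≤ t) :
    zigzagIntensity a (Ioc s t) = ENNReal.ofReal (a * Real.log (t / s)) := by
  have hsub : Ioc s t ⊆ Ici (0 : ℝ) := fun x hx => hs.le.trans hx.1.le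
  have hnz : (0 : ℝ) ∉ uIcc s t := by
    rw [uIcc_of_le hst]
    exact fun h => not_le_of_gt hs h.1
  have hint : IntervalIntegrable (fun x : ℝ => a / x) volume s t := by
    refine ContinuousOn.intervalIntegrable ?_
    exact continuousOn_const.div continuousOn_id fun x hx h => hnz (h ▸ hx)
  rw [zigzagIntensity, withDensity_apply _ measurableSet_Ioc,
    Measure.restrict_restrict measurableSet_Ioc, inter_eq_left.2 hsub,
    ← ofReal_integral_eq_lintegral_ofReal
      ((intervalIntegrable_iff_integrableOn_Ioc_of_le hst).1 hint),
    ← intervalIntegral.integral_of_le hst]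
  · congr 1
    simp only [div_eq_mul_inv a]
    rw [intervalIntegral.integral_const_mul, integral_inv_of_pos hs (hs.trans_le hst)]
  · filter_upwards [ae_restrict_mem measurableSet_Ioc] with x hx
    exact div_nonneg ha.le (hs.le.trans hx.1.le)

theorem zigzagIntensity_Ioc_ne_top {a s t : ℝ} (ha : 0 < a) (hs : 0 < s) :
    zigzagIntensity a (Ioc s t) ≠ ∞ := by
  rcases le_total s t with h | h
  · rw [zigzagIntensity_Ioc ha hs h]
    exact ENNReal.ofReal_ne_top
  · rw [Ioc_eq_empty_of_le h]
    simp

theorem poissonLaw_apply {m : ℝ≥0∞} (hm : m ≠ ∞) (s : Set ℕ∞) :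
    poissonLaw m s = poissonMeasure m.toNNReal ((fun n : ℕ => (n : ℕ∞)) ⁻¹' s) := by
  rw [poissonLaw, if_neg hm, Measure.map_apply (measurable_of_countable _) (.of_discrete)]

section

variable {Ω : Type*} [MeasurableSpace Ω] {P : Measure Ω} {N : Ω → Set ℝ} {μ : Measure ℝ}

theorem IsPoissonPointProcess.measure_pointCount_eq (hN : IsPoissonPointProcess N μ P) {A : Set ℝ}
    (hA : MeasurableSet A) (hμ : μ A ≠ ∞) (k : ℕ) :
    P (pointCount N A ⁻¹' {(k : ℕ∞)}) = poissonMeasure (μ A).toNNReal {k} := by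
  rw [← Measure.map_apply (hN.measurable A hA) (.of_discrete), hN.law A hA, poissonLaw_apply hμ]
  congr 1
  ext n
  simp

theorem IsPoissonPointProcess.ae_finite (hN : IsPoissonPointProcess N μ P) {A : Set ℝ}
    (hA : MeasurableSet A) (hμ : μ A ≠ ∞) : ∀ᵐ ω ∂P, (N ω ∩ A).Finite := by
  have h : P (pointCount N A ⁻¹' {⊤}) = 0 := by
    rw [← Measure.map_apply (hN.measurable A hA) (.of_discrete), hN.law A hA, poissonLaw_apply hμ]
    convert measure_empty (μ := poissonMeasure (μ A).toNNReal)
    ext n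
    simp
  rw [ae_iff]
  convert h using 2
  ext ω
  simp [pointCount]

/-- Independence of a family is tested on finite subfamilies, which are reindexed by `Fin k`. -/
theorem IsPoissonPointProcess.iIndepFun_pointCount (hN : IsPoissonPointProcess N μ P)
    {ι : Type*} {A : ι → Set ℝ} (hA : ∀ i, MeasurableSet (A i))
    (hd : Pairwise (Function.onFun Disjoint A)) : iIndepFun (fun i => pointCount N (A i)) P := by
  rw [iIndepFun_iff_finset]
  intro s
  have h := hN.indep s.card (fun i => A (s.equivFin.symm i)) (fun i => hA _)
    fun i j hij => hd fun h => hij (s.equivFin.symm.injective (Subtype.ext h))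
  have h2 := h.precomp s.equivFin.injective
  simp only [Equiv.symm_apply_apply] at h2
  exact h2

/-- Almost surely some triple of consecutive segments of the geometric partition `3 ^ i * u`
holds no point, exactly one point, and no point. -/
theorem IsPoissonPointProcess.ae_exists_pattern [IsProbabilityMeasure P] {c : ℝ} (hc : 0 < c)
    (hN : IsPoissonPointProcess N (zigzagIntensity c) P) {u : ℝ} (hu : 0 < u) :
    ∀ᵐ ω ∂P, ∃ v, u ≤ v ∧ N ω ∩ Ioc v (3 * v) = ∅ ∧ (N ω ∩ Ioc (3 * v) (9 * v)).ncard = 1 ∧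
      N ω ∩ Ioc (9 * v) (27 * v) = ∅ := by
  set t : ℕ → ℝ := fun i => 3 ^ i * u with ht
  have htpos : ∀ i, 0 < t i := fun i => by positivity
  have hsucc : ∀ i, t (i + 1) = 3 * t i := fun i => by simp only [ht]; ring
  have hmono : Monotone t := monotone_nat_of_le_succ fun i => by
    rw [hsucc]; linarith [htpos i]
  set X : ℕ → Ω → ℕ∞ := fun i => pointCount N (Ioc (t i) (t (i + 1))) with hX
  have hind : iIndepFun X P :=
    hN.iIndepFun_pointCount (fun i => measurableSet_Ioc) hmono.pairwise_disjoint_on_Ioc_succ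
  have hXm : ∀ i, Measurable (X i) := fun i => hN.measurable _ measurableSet_Ioc
  -- The common mean `c log 3` of all segments, by scale invariance of `dx/x`.
  set r : ℝ≥0 := (ENNReal.ofReal (c * Real.log 3)).toNNReal with hr
  have hr0 : 0 < r := by
    have : 0 < c * Real.log 3 := mul_pos hc (Real.log_pos (by norm_num))
    exact Real.toNNReal_pos.2 this
  have hprob : ∀ i k : ℕ, P (X i ⁻¹' {(k : ℕ∞)}) = poissonMeasure r {k} := by
    intro i k
    rw [hX, hN.measure_pointCount_eq measurableSet_Ioc (zigzagIntensity_Ioc_ne_top hc (htpos i)),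
      zigzagIntensity_Ioc hc (htpos i) (hmono i.le_succ), hsucc,
      mul_div_cancel_right₀ _ (htpos i).ne']
  have hpos : ∀ k : ℕ, 0 < poissonMeasure r {k} := by
    intro k
    rw [poissonMeasure_singleton, ENNReal.ofReal_pos]
    positivity
  -- The required counts, with period `0, 1, 0`; `D j` asks for them on the `j`-th triple of
  -- segments.
  set f : ℕ → ℕ := fun i => if i % 3 = 1 then 1 else 0 with hf
  set q : ℝ≥0∞ := min (poissonMeasure r {0}) (poissonMeasure r {1}) with hq
  have hfq : ∀ i, q ≤ poissonMeasure r {f i} := by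
    intro i
    simp only [hf]
    split_ifs
    · exact min_le_right _ _
    · exact min_le_left _ _
  set D : ℕ → Set Ω := fun j => ⋂ i ∈ Finset.Ico (3 * j) (3 * j + 3), X i ⁻¹' {(f i : ℕ∞)} with hD
  have hDq : ∀ j, q ^ 3 ≤ P (D j) := by
    intro j
    rw [hD, hind.measure_inter_preimage_eq_mul (Finset.Ico (3 * j) (3 * j + 3))
      (sets := fun i => {(f i : ℕ∞)}) fun _ _ => measurableSet_singleton _]
    have hcard : (Finset.Ico (3 * j) (3 * j + 3)).card = 3 := by simp
    conv_lhs => rw [← hcard, ← Finset.prod_const]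
    exact Finset.prod_le_prod' fun i _ => (hfq i).trans_eq (hprob i (f i)).symm
  have hS : Monotone fun j : ℕ => 3 * j := fun i j h => Nat.mul_le_mul_left 3 h
  have hb := measure_biInter_compl_le (m := fun i => MeasurableSpace.comap (X i) inferInstance)
    (fun i => (hXm i).comap_le) hind.iIndep hS.pairwise_disjoint_on_Ico_succ (D := D)
    (fun j => Finset.measurableSet_biInter _ fun i hi =>
      (Measurable.of_comap_le (le_iSup₂_of_le i
        (by rw [Finset.mem_Ico] at hi; exact ⟨hi.1, by rw [Order.succ_eq_add_one]; lia⟩) le_rfl))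
        (measurableSet_singleton _)) hDq
  have hex : ∀ᵐ ω ∂P, ∃ j, ω ∈ D j := by
    rw [ae_iff]
    refine le_antisymm (ge_of_tendsto' (tendsto_one_sub_pow (δ := q ^ 3) ?_) fun J => ?_) bot_le
    · exact pos_iff_ne_zero.2 (pow_ne_zero _ (lt_min (hpos 0) (hpos 1)).ne')
    · refine (measure_mono fun ω hω => ?_).trans (hb J)
      simp only [mem_iInter]
      exact fun j _ h => hω ⟨j, h⟩
  filter_upwards [hex] with ω ⟨j, hj⟩
  simp only [hD, mem_iInter, Finset.mem_Ico, mem_preimage, mem_singleton_iff] at hj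
  have h0 := hj (3 * j) ⟨by lia, by lia⟩
  have h1 := hj (3 * j + 1) ⟨by lia, by lia⟩
  have h2 := hj (3 * j + 2) ⟨by lia, by lia⟩
  have e1 : t (3 * j + 1) = 3 * t (3 * j) := hsucc _
  have e2 : t (3 * j + 2) = 9 * t (3 * j) := by rw [hsucc, e1]; ring
  have e3 : t (3 * j + 2 + 1) = 27 * t (3 * j) := by rw [hsucc, e2]; ring
  have f0 : f (3 * j) = 0 := by simp [hf]
  have f1 : f (3 * j + 1) = 1 := by simp only [hf]; rw [if_pos (by lia)]
  have f2 : f (3 * j + 2) = 0 := by simp only [hf]; rw [if_neg (by lia)]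
  simp only [hX, pointCount, e1, e2, e3, f0, f1, f2, Nat.cast_zero, Nat.cast_one,
    encard_eq_zero] at h0 h1 h2
  refine ⟨t (3 * j), ?_, h0, ?_, h2⟩
  · simpa [ht] using hmono (Nat.zero_le (3 * j))
  · rw [ncard, h1]
    rfl

end

/-! ### Recurrence of the zigzag process -/

theorem IsZigzagProcess.isRecurrentProcess {Ω : Type*} [MeasurableSpace Ω] {P : Measure Ω}
    [IsProbabilityMeasure P] {c : ℝ} (hc : 0 < c) {X : ℝ≥0 → Ω → ℝ}
    (hX : IsZigzagProcess c X P) : IsRecurrentProcess X P := by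
  obtain ⟨N, ε, t₀, ht₀, hN, -, -, -, -, hXeq⟩ := hX
  -- Finiteness makes the parity of `ncard` meaningful, since `ncard` is 0 on infinite sets; integer
  -- endpoints reduce it to countably many events.
  have hfin : ∀ᵐ ω ∂P, ∀ n : ℕ, (N ω ∩ Ioc t₀ n).Finite :=
    ae_all_iff.2 fun n => hN.ae_finite measurableSet_Ioc (zigzagIntensity_Ioc_ne_top hc ht₀)
  have hpat : ∀ᵐ ω ∂P, ∀ n : ℕ, ∃ v, max t₀ n ≤ v ∧ N ω ∩ Ioc v (3 * v) = ∅ ∧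
      (N ω ∩ Ioc (3 * v) (9 * v)).ncard = 1 ∧ N ω ∩ Ioc (9 * v) (27 * v) = ∅ :=
    ae_all_iff.2 fun n => hN.ae_exists_pattern hc (lt_max_of_lt_left ht₀)
  filter_upwards [hfin, hpat] with ω h1 h2 T
  obtain ⟨v, hv, p1, p2, p3⟩ := h2 ⌈T⌉₊
  obtain ⟨t, ht, h⟩ := exists_zigzagPath_eq_zero ht₀
    (fun s => (h1 ⌈s⌉₊).subset (inter_subset_inter_right _ (Ioc_subset_Ioc_right (Nat.le_ceil s))))
    ((le_max_left _ _).trans hv) p1 p2 p3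
  have hTt : (T : ℝ) ≤ t := by
    have : (T : ℝ) ≤ (⌈T⌉₊ : ℝ) := by exact_mod_cast Nat.le_ceil T
    exact this.trans ((le_max_right _ _).trans (hv.trans ht))
  have ht0 : 0 ≤ t := T.coe_nonneg.trans hTt
  refine ⟨t.toNNReal, NNReal.le_toNNReal_of_coe_le hTt, ?_⟩
  rw [hXeq, Real.coe_toNNReal t ht0, h, mul_zero]

end CoinTurning

theorem mainTheorem7 (p : ℕ → ℝ) (hp : ∀ n, 1 ≤ n → p n ∈ Set.Icc (0 : ℝ) 1)
    (c : ℝ) (hc : 0 < c)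
    {Ω : Type*} [MeasurableSpace Ω] (P : Measure Ω) [IsProbabilityMeasure P]
    (W : ℕ → Ω → Bool) (hW : CoinTurning.IsTurnSequence p W P) :
    ((∃ n₀ : ℕ, 1 ≤ n₀ ∧ ∀ n, n₀ ≤ n → p n ≤ c / n) →
      Tendsto (fun n : ℕ => ∑ k ∈ Finset.Icc 1 n, p k) atTop atTop →
      CoinTurning.IsRecurrentWalk W P) ∧
    ((∃ n₀ : ℕ, 1 ≤ n₀ ∧ ∀ n, n₀ ≤ n → p n = c / n) →
      (∀ (Ω' : Type*) [MeasurableSpace Ω'] (P' : Measure Ω') [IsProbabilityMeasure P']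
        (X : ℝ≥0 → Ω' → ℝ), CoinTurning.IsZigzagProcess c X P' →
        CoinTurning.IsRecurrentProcess X P') ∧
      (∀ (Ω' : Type*) [MeasurableSpace Ω'] (P' : Measure Ω') [IsProbabilityMeasure P']
        (Z : Ω' → C(ℝ≥0, ℝ)), CoinTurning.IsScalingLimit W P Z P' →
        CoinTurning.IsRecurrentProcess (fun t ω => Z ω t) P')) := by
  refine ⟨fun ⟨n₀, _, h⟩ hsum => ?_, fun ⟨n₀, _, h⟩ => ⟨?_, ?_⟩⟩
  · exact hW.isRecurrentWalk (hW.ae_frequently_walk_eq_zero hp hc h hsum)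
  · intro Ω' _ P' _ X hX
    exact hX.isRecurrentProcess hc
  · intro Ω' _ P' _ Z hZ
    exact hW.isRecurrentProcess_scalingLimit hp hc h hZ
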